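/- Let $\Omega\subset\mathbb{R}^3$ be a bounded open set with Lipschitz boundary: every $x_0\in\partial\Omega$ has an open neighbourhood $V$ such that, in suitable orthonormal coordinates $y=(y_1,y_2,y_3)$ and for some Lipschitz function $g:\mathbb{R}^2\to\mathbb{R}$, $\partial\Omega\cap V=\{y\in V: y_3=g(y_1,y_2)\}$ and $\Omega\cap V=\{y\in V: y_3>g(y_1,y_2)\}$. Let $1<p<\infty$ and let $$W^p(\mathrm{div};\Omega)=\{\mathbf u\in L^p(\Omega)^3:\ \nabla\cdot\mathbf u\in L^p(\Omega)\},\qquad \|\mathbf u\|_{W^p(\mathrm{div};\Omega)}=\|\mathbf u\|_{L^p(\Omega)}+\|\nabla\cdot\mathbf u\|_{L^p(\Omega)},$$ where the divergence is taken in the sense of distributions on $\Omega$. Let $C^\infty(\overline\Omega)^3$ denote the set of restrictions to $\overline\Omega$ of $C^\infty$ vector fields $\mathbb{R}^3\to\mathbb{R}^3$. Then $C^\infty(\overline\Omega)^3$ is contained in $W^p(\mathrm{div};\Omega)$ and is dense in it. -/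

import Mathlib

open MeasureTheory Set
open scoped ENNReal NNReal ContDiff

noncomputable section

/-- Three-dimensional Euclidean space. -/
abbrev E3 : Type := EuclideanSpace ℝ (Fin 3)

/-- The first two coordinates of a point of `ℝ³`. -/
def horiz (y : E3) : EuclideanSpace ℝ (Fin 2) := !₂[y 0, y 1]

/-- `Ω` has a Lipschitz boundary: near each boundary point, in suitable orthonormal coordinates
`y = e x`, the boundary is the graph of a Lipschitz function `g` of the first two coordinates, and
`Ω` is the part lying strictly above that graph. -/
def HasLipschitzBoundary (Ω : Set E3) : Prop :=
  ∀ x₀ ∈ frontier Ω, ∃ V : Set E3, IsOpen V ∧ x₀ ∈ V ∧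
    ∃ (e : E3 ≃ₗᵢ[ℝ] E3) (K : ℝ≥0) (g : EuclideanSpace ℝ (Fin 2) → ℝ), LipschitzWith K g ∧
      Ω ∩ V = {x | g (horiz (e x)) < e x 2} ∩ V ∧
      frontier Ω ∩ V = {x | g (horiz (e x)) = e x 2} ∩ V

/-- `φ ∈ C₀^∞(Ω)`, the scalar test functions on `Ω`. -/
def IsTestFunction (Ω : Set E3) (φ : E3 → ℝ) : Prop :=
  ContDiff ℝ ∞ φ ∧ HasCompactSupport φ ∧ tsupport φ ⊆ Ω

/-- `d` is the divergence of `u` on `Ω` in the sense of distributions. -/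
def IsWeakDiv (Ω : Set E3) (u : E3 → E3) (d : E3 → ℝ) : Prop :=
  ∀ φ : E3 → ℝ, IsTestFunction Ω φ →
    ∫ x in Ω, inner ℝ (u x) (gradient φ x) = - ∫ x in Ω, d x * φ x

/-- `L^p(Ω)^3`. -/
abbrev LpField (p : ℝ≥0∞) (Ω : Set E3) := Lp E3 p (volume.restrict Ω)

/-- `L^p(Ω)`. -/
abbrev LpScalar (p : ℝ≥0∞) (Ω : Set E3) := Lp ℝ p (volume.restrict Ω)

theorem IsTestFunction.integrable_div {p : ℝ≥0∞} [Fact (1 ≤ p)] {Ω : Set E3} {φ : E3 → ℝ}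
    (hφ : IsTestFunction Ω φ) (d : LpScalar p Ω) :
    Integrable (fun x => d x * φ x) (volume.restrict Ω) :=
  ((Lp.memLp d).locallyIntegrable Fact.out).integrable_smul_right_of_hasCompactSupport
    hφ.1.continuous hφ.2.1

theorem IsTestFunction.integrable_grad {p : ℝ≥0∞} [Fact (1 ≤ p)] {Ω : Set E3} {φ : E3 → ℝ}
    (hφ : IsTestFunction Ω φ) (u : LpField p Ω) :
    Integrable (fun x => inner ℝ (u x) (gradient φ x)) (volume.restrict Ω) := by
  have hc : Continuous (gradient φ) :=
    (InnerProductSpace.toDual ℝ E3).symm.continuous.comp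
      (hφ.1.continuous_fderiv (by simp))
  have hs : HasCompactSupport (gradient φ) :=
    (hφ.2.1.fderiv ℝ).comp_left (g := (InnerProductSpace.toDual ℝ E3).symm) (map_zero _)
  have hl : LocallyIntegrable (fun x => ‖u x‖) (volume.restrict Ω) :=
    (Lp.memLp u).norm.locallyIntegrable Fact.out
  have hb : Integrable (fun x => ‖u x‖ * ‖gradient φ x‖) (volume.restrict Ω) :=
    hl.integrable_smul_right_of_hasCompactSupport hc.norm hs.norm
  refine hb.mono' ((Lp.aestronglyMeasurable u).inner hc.aestronglyMeasurable) ?_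
  exact Filter.Eventually.of_forall fun x => norm_inner_le_norm _ _

/-- The space `W^p(div; Ω)` of all `u ∈ L^p(Ω)^3` whose distributional divergence lies in `L^p(Ω)`.
An element is stored as the pair `(u, div u)`, so that the norm inherited from the `ℓ¹`-product is
`‖u‖_{L^p} + ‖div u‖_{L^p}`; for open `Ω` the second entry is determined by the first. -/
def WpDiv (p : ℝ≥0∞) [Fact (1 ≤ p)] (Ω : Set E3) :
    Submodule ℝ (WithLp 1 (LpField p Ω × LpScalar p Ω)) where
  carrier := {w | IsWeakDiv Ω w.fst w.snd}
  zero_mem' := by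
    intro φ _
    have h₁ : ∫ x in Ω, inner ℝ ((0 : LpField p Ω) x) (gradient φ x) = 0 := by
      rw [← integral_zero E3 ℝ (μ := volume.restrict Ω)]
      refine integral_congr_ae ?_
      filter_upwards [Lp.coeFn_zero E3 p (volume.restrict Ω)] with x hx
      rw [hx, Pi.zero_apply, inner_zero_left]
    have h₂ : ∫ x in Ω, (0 : LpScalar p Ω) x * φ x = 0 := by
      rw [← integral_zero E3 ℝ (μ := volume.restrict Ω)]
      refine integral_congr_ae ?_
      filter_upwards [Lp.coeFn_zero ℝ p (volume.restrict Ω)] with x hx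
      rw [hx, Pi.zero_apply, zero_mul]
    rw [WithLp.zero_fst, WithLp.zero_snd, h₁, h₂, neg_zero]
  add_mem' := by
    intro v w hv hw φ hφ
    have h₁ : ∫ x in Ω, inner ℝ ((v.fst + w.fst) x) (gradient φ x) =
        (∫ x in Ω, inner ℝ (v.fst x) (gradient φ x)) +
          ∫ x in Ω, inner ℝ (w.fst x) (gradient φ x) := by
      rw [← integral_add (hφ.integrable_grad v.fst) (hφ.integrable_grad w.fst)]
      refine integral_congr_ae ?_
      filter_upwards [Lp.coeFn_add v.fst w.fst] with x hx
      rw [hx, Pi.add_apply, inner_add_left]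
    have h₂ : ∫ x in Ω, (v.snd + w.snd) x * φ x =
        (∫ x in Ω, v.snd x * φ x) + ∫ x in Ω, w.snd x * φ x := by
      rw [← integral_add (hφ.integrable_div v.snd) (hφ.integrable_div w.snd)]
      refine integral_congr_ae ?_
      filter_upwards [Lp.coeFn_add v.snd w.snd] with x hx
      rw [hx, Pi.add_apply, add_mul]
    rw [WithLp.add_fst, WithLp.add_snd, h₁, h₂, hv φ hφ, hw φ hφ, neg_add]
  smul_mem' := by
    intro c w hw φ hφ
    have h₁ : ∫ x in Ω, inner ℝ ((c • w.fst) x) (gradient φ x) =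
        c * ∫ x in Ω, inner ℝ (w.fst x) (gradient φ x) := by
      rw [← integral_const_mul]
      refine integral_congr_ae ?_
      filter_upwards [Lp.coeFn_smul c w.fst] with x hx
      rw [hx, Pi.smul_apply, real_inner_smul_left]
    have h₂ : ∫ x in Ω, (c • w.snd) x * φ x = c * ∫ x in Ω, w.snd x * φ x := by
      rw [← integral_const_mul]
      refine integral_congr_ae ?_
      filter_upwards [Lp.coeFn_smul c w.snd] with x hx
      rw [hx, Pi.smul_apply, smul_eq_mul, mul_assoc]
    rw [WithLp.smul_fst, WithLp.smul_snd, h₁, h₂, hw φ hφ, mul_neg]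

namespace WpDiv

variable {p : ℝ≥0∞} [Fact (1 ≤ p)] {Ω : Set E3}

/-- The vector field `u ∈ L^p(Ω)^3` underlying an element of `W^p(div; Ω)`. -/
def field (w : WpDiv p Ω) : LpField p Ω := w.1.fst

/-- The weak divergence `div u ∈ L^p(Ω)`. -/
def div (w : WpDiv p Ω) : LpScalar p Ω := w.1.snd

theorem isWeakDiv (w : WpDiv p Ω) : IsWeakDiv Ω (field w) (div w) := w.2

theorem norm_eq (w : WpDiv p Ω) : ‖w‖ = ‖field w‖ + ‖div w‖ :=
  WithLp.prod_norm_eq_of_L1 (w : WithLp 1 (LpField p Ω × LpScalar p Ω))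

/-- On an open set the weak divergence is determined by the field. -/
theorem field_injective (hΩ : IsOpen Ω) :
    Function.Injective (field : WpDiv p Ω → LpField p Ω) := by
  intro v w h
  have hli : LocallyIntegrable (fun x => div v x - div w x) (volume.restrict Ω) :=
    ((Lp.memLp (div v)).locallyIntegrable Fact.out).sub
      ((Lp.memLp (div w)).locallyIntegrable Fact.out)
  have hz := hΩ.ae_eq_zero_of_integral_contDiff_smul_eq_zero (hli.locallyIntegrableOn Ω) (by
    intro φ h₁ h₂ h₃
    have hφ : IsTestFunction Ω φ := ⟨h₁, h₂, h₃⟩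
    have hv := isWeakDiv v φ hφ
    have hw := isWeakDiv w φ hφ
    rw [h] at hv
    have he : ∀ x, φ x • (div v x - div w x) = div v x * φ x - div w x * φ x := fun x => by
      rw [smul_eq_mul]; ring
    simp_rw [he]
    rw [integral_sub (hφ.integrable_div _) (hφ.integrable_div _)]
    linarith)
  have hd : div v = div w := by
    refine Lp.ext ?_
    filter_upwards [hz, ae_restrict_mem hΩ.measurableSet] with x hx hxΩ
    exact sub_eq_zero.1 (hx hxΩ)
  exact Subtype.ext ((WithLp.ofLp_injective 1) (Prod.ext h hd))

end WpDiv

/-- `C^∞(Ω̄)^3`: vector fields which on `Ω̄` agree with a smooth field defined on all of `ℝ³`. -/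
def SmoothUpToBoundary (Ω : Set E3) : Set (E3 → E3) :=
  {φ | ∃ ψ : E3 → E3, ContDiff ℝ ∞ ψ ∧ EqOn φ ψ (closure Ω)}

end

/-! Smooth fields on a bounded set lie in the space by integration by parts; density is the
substance. Mollification commutes with the weak divergence at `x` only if the kernel, seen from `x`,
stays inside Ω, and a centred kernel fails this near the boundary. A Lipschitz boundary supplies,
locally, a direction v such that every point within δt of x + tv lies in Ω whenever x does
(`HasLipschitzBoundary.exists_uniformConeNear`). A bump centred at -tv of radius δt therefore
averages only over Ω (`UniformConeNear.exists_kernel`).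

With a cut-off χ, the field χu and the function χ div u + ∇χ·u are extended by zero and mollified by
the same kernel K. The zero extension of χu may have a singular divergence on ∂Ω, but on Ω the
divergence of its mollification is exactly the mollified function (`WpDiv.integral_fderiv_kernel`).
Both errors are small by continuity of translations in L^p, which needs p < ∞. A partition of unity
assembles the local approximations. -/

/-! ### Translations and mollification in L^p -/

theorem MeasureTheory.MemLp.tendsto_eLpNorm_translate_sub {F : Type*} [NormedAddCommGroup F]
    {p : ℝ≥0∞} [Fact (1 ≤ p)] (hp : p ≠ ⊤) {f : E3 → F} (hf : MemLp f p volume) :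
    Filter.Tendsto (fun z => eLpNorm (fun x => f (x - z) - f x) p volume) (nhds 0) (nhds 0) := by
  have : Fact (p ≠ ⊤) := ⟨hp⟩
  have hc : Continuous fun z : E3 => DomAddAct.mk (-z) +ᵥ hf.toLp f :=
    (DomAddAct.continuous_mk.comp continuous_neg).vadd continuous_const
  have h := (hc.tendsto 0).edist (tendsto_const_nhds (x := hf.toLp f))
  simp only [neg_zero, DomAddAct.mk_zero, zero_vadd, edist_self] at h
  refine h.congr fun z => ?_
  rw [DomAddAct.mk_vadd_toLp, Lp.edist_toLp_toLp]
  refine eLpNorm_congr_ae (Filter.Eventually.of_forall fun x => ?_)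
  simp [vadd_eq_add, sub_eq_neg_add]

/-- K dz is a probability measure ν, so K * f - f is a ν-average of translation differences.
Jensen's inequality, here as L¹ ≤ L^p for ν, followed by Tonelli gives the bound. K need not be
centred at 0. -/
theorem MeasureTheory.eLpNorm_convolution_sub_le {F : Type*} [NormedAddCommGroup F]
    [NormedSpace ℝ F] [CompleteSpace F] {p : ℝ≥0∞} [hp1 : Fact (1 ≤ p)] (hp : p ≠ ⊤)
    {f : E3 → F} (hfm : StronglyMeasurable f) (hf : LocallyIntegrable f volume) {K : E3 → ℝ}
    (hK : Continuous K) (hKs : HasCompactSupport K) (hK0 : ∀ z, 0 ≤ K z) (hK1 : ∫ z, K z = 1)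
    {C : ℝ≥0∞} (hC : ∀ z, K z ≠ 0 → eLpNorm (fun x => f (x - z) - f x) p volume ≤ C) :
    eLpNorm (fun x => convolution K f (ContinuousLinearMap.lsmul ℝ ℝ) volume x - f x) p volume
      ≤ C := by
  have hp0 : p ≠ 0 := (zero_lt_one.trans_le hp1.out).ne'
  have hpr : 0 < p.toReal := ENNReal.toReal_pos hp0 hp
  have hKi : Integrable K volume := hK.integrable_of_hasCompactSupport hKs
  set κ : E3 → ℝ≥0∞ := fun z => ENNReal.ofReal (K z) with hκ
  have hκm : Measurable κ := hK.measurable.ennreal_ofReal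
  set ν : Measure E3 := volume.withDensity κ with hν
  have : IsProbabilityMeasure ν := by
    constructor
    rw [hν, withDensity_apply _ MeasurableSet.univ, Measure.restrict_univ,
      ← ofReal_integral_eq_lintegral_ofReal hKi (Filter.Eventually.of_forall hK0), hK1,
      ENNReal.ofReal_one]
  have hsm : StronglyMeasurable fun q : E3 × E3 => f (q.1 - q.2) - f q.1 :=
    (hfm.comp_measurable (measurable_fst.sub measurable_snd)).sub
      (hfm.comp_measurable measurable_fst)
  have hpt : ∀ x, ‖convolution K f (ContinuousLinearMap.lsmul ℝ ℝ) volume x - f x‖ₑ ^ p.toReal ≤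
      ∫⁻ z, ‖f (x - z) - f x‖ₑ ^ p.toReal ∂ν := by
    intro x
    have hex : Integrable (fun z => K z • f (x - z)) volume :=
      hKs.convolutionExists_left (ContinuousLinearMap.lsmul ℝ ℝ) hK hf x
    have heq : convolution K f (ContinuousLinearMap.lsmul ℝ ℝ) volume x - f x =
        ∫ z, (f (x - z) - f x) ∂ν := by
      rw [hν, integral_withDensity_eq_integral_toReal_smul hκm
        (Filter.Eventually.of_forall fun z => ENNReal.ofReal_lt_top)]
      simp only [hκ, ENNReal.toReal_ofReal (hK0 _), smul_sub]
      rw [integral_sub hex (hKi.smul_const _), integral_smul_const, hK1, one_smul]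
      rfl
    have h1 : ‖∫ z, (f (x - z) - f x) ∂ν‖ₑ ≤ eLpNorm (fun z => f (x - z) - f x) p ν := by
      refine (enorm_integral_le_lintegral_enorm _).trans ?_
      rw [← eLpNorm_one_eq_lintegral_enorm]
      exact eLpNorm_le_eLpNorm_of_exponent_le hp1.out
        (hsm.comp_measurable measurable_prodMk_left).aestronglyMeasurable
    rw [heq]
    refine (ENNReal.rpow_le_rpow h1 hpr.le).trans ?_
    rw [eLpNorm_eq_lintegral_rpow_enorm_toReal hp0 hp, ← ENNReal.rpow_mul,
      one_div_mul_cancel hpr.ne', ENNReal.rpow_one]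
  rw [eLpNorm_eq_lintegral_rpow_enorm_toReal hp0 hp, one_div, ENNReal.rpow_inv_le_iff hpr]
  calc ∫⁻ x, ‖convolution K f (ContinuousLinearMap.lsmul ℝ ℝ) volume x - f x‖ₑ ^ p.toReal
      ≤ ∫⁻ x, ∫⁻ z, ‖f (x - z) - f x‖ₑ ^ p.toReal ∂ν := lintegral_mono hpt
    _ = ∫⁻ z, ∫⁻ x, ‖f (x - z) - f x‖ₑ ^ p.toReal ∂volume ∂ν :=
        lintegral_lintegral_swap (hsm.enorm.pow_const p.toReal).aemeasurable
    _ ≤ ∫⁻ _, C ^ p.toReal ∂ν := by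
        refine lintegral_mono_ae ?_
        rw [hν, ae_withDensity_iff hκm]
        refine Filter.Eventually.of_forall fun z hz => ?_
        have hz' : K z ≠ 0 := fun h => hz (by simp [hκ, h])
        have := hC z hz'
        rwa [eLpNorm_eq_lintegral_rpow_enorm_toReal hp0 hp, one_div,
          ENNReal.rpow_inv_le_iff hpr] at this
    _ = C ^ p.toReal := by simp

/-! ### The cone property of Lipschitz domains -/

/-- Near `x₀`, points close to an inward translate of a point of `Ω` lie in `Ω`. -/
def UniformConeNear (Ω U : Set E3) : Prop :=
  ∃ (v : E3) (δ h : ℝ), 0 < δ ∧ 0 < h ∧ ∀ x ∈ Ω, ∀ t, 0 < t → t < h →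
    ∀ y ∈ U, ‖y - (x + t • v)‖ ≤ δ * t → y ∈ Ω

theorem norm_horiz_le (y : E3) : ‖horiz y‖ ≤ ‖y‖ := by
  rw [EuclideanSpace.norm_eq, EuclideanSpace.norm_eq]
  refine Real.sqrt_le_sqrt ?_
  simp only [horiz, Fin.sum_univ_two, Fin.sum_univ_three]
  simp [sq_nonneg]

theorem horiz_sub (y z : E3) : horiz y - horiz z = horiz (y - z) := by
  ext i
  fin_cases i <;> simp [horiz]

/-- At a boundary point take v vertical in the graph coordinates. Moving by tv raises the height
above the graph by t, while a further displacement q lowers it by at most (K + 1)‖q‖; hence the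
aperture 1/(K + 1). -/
theorem HasLipschitzBoundary.exists_uniformConeNear {Ω : Set E3} (hΩ : IsOpen Ω)
    (hL : HasLipschitzBoundary Ω) {x₀ : E3} (hx₀ : x₀ ∈ closure Ω) :
    ∃ U : Set E3, IsOpen U ∧ x₀ ∈ U ∧ UniformConeNear Ω U := by
  by_cases hx : x₀ ∈ Ω
  · exact ⟨Ω, hΩ, hx, 0, 1, 1, one_pos, one_pos, fun _ _ _ _ _ y hy _ => hy⟩
  obtain ⟨V, hV, hxV, e, K, g, hg, hgV, -⟩ := hL x₀ ⟨hx₀, by rwa [hΩ.interior_eq]⟩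
  obtain ⟨r, hr, hrV⟩ := Metric.isOpen_iff.1 hV x₀ hxV
  set v : E3 := e.symm (EuclideanSpace.single 2 1) with hv
  have hvn : ‖v‖ = 1 := by simp [hv]
  have hev : e v = EuclideanSpace.single 2 1 := by simp [hv]
  have hK : (0 : ℝ) ≤ K := K.2
  -- Since ‖x - y‖ ≤ 2t < r/2, these radii force x, as well as y, into the chart V.
  refine ⟨Metric.ball x₀ (r / 2), Metric.isOpen_ball, Metric.mem_ball_self (half_pos hr), v,
    1 / (K + 1), r / 4, by positivity, by positivity, fun x hxΩ t ht htr y hy hyx => ?_⟩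
  have hδ : 1 / ((K : ℝ) + 1) ≤ 1 := by
    rw [div_le_one (by positivity)]; linarith
  have hyV : y ∈ V := hrV (Metric.ball_subset_ball (by linarith) hy)
  have hyx' : ‖y - (x + t • v)‖ ≤ t := hyx.trans (by nlinarith)
  have hxy : ‖x - y‖ ≤ 2 * t := by
    have h1 : x - y = -(y - (x + t • v)) - t • v := by abel
    rw [h1]
    refine (norm_sub_le _ _).trans ?_
    rw [norm_neg, norm_smul, hvn, Real.norm_of_nonneg ht.le]
    linarith
  have hxV' : x ∈ V := by
    refine hrV ?_
    rw [Metric.mem_ball, dist_eq_norm] at hy ⊢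
    have h2 : x - x₀ = (x - y) + (y - x₀) := by abel
    rw [h2]
    linarith [norm_add_le (x - y) (y - x₀)]
  have hgx : g (horiz (e x)) < e x 2 := ((hgV ▸ (⟨hxΩ, hxV'⟩ : x ∈ Ω ∩ V)) :
    x ∈ {x | g (horiz (e x)) < e x 2} ∩ V).1
  set q : E3 := e (y - (x + t • v)) with hq
  have hqn : ‖q‖ ≤ 1 / ((K : ℝ) + 1) * t := by rw [hq, e.norm_map]; exact hyx
  have hey : e y = e x + t • EuclideanSpace.single 2 1 + q := by
    rw [hq, map_sub, map_add, map_smul, hev]; abel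
  have h2 : e y 2 = e x 2 + t + q 2 := by simp [hey]
  have hq2 : -‖q‖ ≤ q 2 := (abs_le.1 (PiLp.norm_apply_le q 2)).1
  have hh : horiz (e y) - horiz (e x) = horiz q := by
    rw [horiz_sub, hey]
    ext i
    fin_cases i <;> simp [horiz]
  have hgy : g (horiz (e y)) - g (horiz (e x)) ≤ K * ‖q‖ := by
    have h3 := hg.dist_le_mul (horiz (e y)) (horiz (e x))
    rw [Real.dist_eq, dist_eq_norm, hh] at h3
    exact (le_abs_self _).trans (h3.trans (mul_le_mul_of_nonneg_left (norm_horiz_le q) hK))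
  have hfin : ((K : ℝ) + 1) * ‖q‖ ≤ t := by
    calc ((K : ℝ) + 1) * ‖q‖ ≤ (K + 1) * (1 / ((K : ℝ) + 1) * t) := by gcongr
      _ = t := by field_simp
  have : y ∈ {x | g (horiz (e x)) < e x 2} ∩ V := ⟨by
    show g (horiz (e y)) < e y 2
    linarith, hyV⟩
  rw [← hgV] at this
  exact this.1

/-! ### Classical and weak divergence -/

/-- The classical divergence of a vector field. -/
noncomputable def divergence (ψ : E3 → E3) (x : E3) : ℝ :=
  ∑ i, fderiv ℝ ψ x (EuclideanSpace.single i 1) i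

theorem sum_smul_single (v : E3) : ∑ i, v i • (EuclideanSpace.single i 1 : E3) = v := by
  ext j
  simp [Pi.single_apply]

theorem inner_gradient_eq (v : E3) (φ : E3 → ℝ) (x : E3) :
    inner ℝ v (gradient φ x) = fderiv ℝ φ x v := by
  rw [inner_gradient_right]; rfl

theorem ContDiff.continuous_divergence {ψ : E3 → E3} (hψ : ContDiff ℝ ∞ ψ) :
    Continuous (divergence ψ) := by
  have h := hψ.continuous_fderiv (by simp)
  unfold divergence
  fun_prop

theorem divergence_sum {ι : Type*} (s : Finset ι) {ψ : ι → E3 → E3}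
    (hψ : ∀ i ∈ s, ContDiff ℝ ∞ (ψ i)) (x : E3) :
    divergence (fun x => ∑ i ∈ s, ψ i x) x = ∑ i ∈ s, divergence (ψ i) x := by
  unfold divergence
  rw [fderiv_fun_sum fun i hi => (hψ i hi).differentiable (by simp) x, Finset.sum_comm]
  simp

theorem Bornology.IsBounded.memLp_of_continuous {F : Type*} [NormedAddCommGroup F]
    {Ω : Set E3} (hb : Bornology.IsBounded Ω) (hΩ : MeasurableSet Ω) {f : E3 → F}
    (hf : Continuous f) (p : ℝ≥0∞) : MemLp f p (volume.restrict Ω) := by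
  have : IsFiniteMeasure (volume.restrict Ω) := ⟨by simpa using hb.measure_lt_top⟩
  obtain ⟨C, hC⟩ := hb.isCompact_closure.exists_bound_of_continuousOn hf.continuousOn
  exact MemLp.of_bound (hf.aestronglyMeasurable) C
    ((ae_restrict_mem hΩ).mono fun x hx => hC x (subset_closure hx))

theorem IsTestFunction.fderiv_eq_zero {Ω : Set E3} {φ : E3 → ℝ} (hφ : IsTestFunction Ω φ)
    {x : E3} (hx : x ∉ Ω) : fderiv ℝ φ x = 0 :=
  fderiv_of_notMem_tsupport ℝ fun h => hx (hφ.2.2 h)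

theorem IsTestFunction.eq_zero {Ω : Set E3} {φ : E3 → ℝ} (hφ : IsTestFunction Ω φ)
    {x : E3} (hx : x ∉ Ω) : φ x = 0 :=
  image_eq_zero_of_notMem_tsupport fun h => hx (hφ.2.2 h)

/-- The classical divergence of a smooth field is its weak divergence. -/
theorem ContDiff.isWeakDiv {ψ : E3 → E3} (hψ : ContDiff ℝ ∞ ψ) (Ω : Set E3) :
    IsWeakDiv Ω ψ (divergence ψ) := by
  intro φ hφ
  have hφd : Continuous (fderiv ℝ φ) := hφ.1.continuous_fderiv (by simp)
  have hψd : Continuous (fderiv ℝ ψ) := hψ.continuous_fderiv (by simp)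
  have hφc := hφ.1.continuous
  have hψc := hψ.continuous
  have hφs : HasCompactSupport (fderiv ℝ φ) := hφ.2.1.fderiv ℝ
  have hcomp : ∀ i, ContDiff ℝ ∞ fun x => ψ x i := fun i => by fun_prop
  have hfd : ∀ i x v, fderiv ℝ (fun x => ψ x i) x v = fderiv ℝ ψ x v i := by
    intro i x v
    have h := (EuclideanSpace.proj (𝕜 := ℝ) i : E3 →L[ℝ] ℝ).hasFDerivAt.comp x
      ((hψ.differentiable (by simp) x).hasFDerivAt)
    exact congrArg (fun A : E3 →L[ℝ] ℝ => A v) h.fderiv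
  have hi : ∀ i : Fin 3, Integrable
      (fun x => ψ x i * fderiv ℝ φ x (EuclideanSpace.single i 1)) volume := fun i =>
    Continuous.integrable_of_hasCompactSupport (by fun_prop)
      (hφs.mono fun x hx h => hx (by simp [h]))
  have hi' : ∀ i : Fin 3, Integrable
      (fun x => fderiv ℝ ψ x (EuclideanSpace.single i 1) i * φ x) volume := fun i =>
    Continuous.integrable_of_hasCompactSupport (by fun_prop) hφ.2.1.mul_left
  have hi'' : ∀ i : Fin 3, Integrable (fun x => ψ x i * φ x) volume := fun i =>
    Continuous.integrable_of_hasCompactSupport (by fun_prop) hφ.2.1.mul_left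
  simp only [inner_gradient_eq]
  -- The test function vanishes off Ω, so integration by parts takes place on all of ℝ³ without
  -- boundary terms.
  rw [setIntegral_eq_integral_of_forall_compl_eq_zero fun x hx => by
      rw [hφ.fderiv_eq_zero hx]; rfl,
    setIntegral_eq_integral_of_forall_compl_eq_zero fun x hx => by
      rw [hφ.eq_zero hx, mul_zero]]
  calc ∫ x, fderiv ℝ φ x (ψ x)
      = ∫ x, ∑ i, ψ x i * fderiv ℝ φ x (EuclideanSpace.single i 1) := by
        refine integral_congr_ae (Filter.Eventually.of_forall fun x => ?_)
        change fderiv ℝ φ x (ψ x) = _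
        conv_lhs => rw [← sum_smul_single (ψ x)]
        simp
    _ = ∑ i, -∫ x, fderiv ℝ ψ x (EuclideanSpace.single i 1) i * φ x := by
        rw [integral_finsetSum _ fun i _ => hi i]
        refine Finset.sum_congr rfl fun i _ => ?_
        rw [integral_mul_fderiv_eq_neg_fderiv_mul_of_integrable]
        · simp only [hfd]
        · simpa only [hfd] using hi' i
        · exact hi i
        · exact hi'' i
        · exact fun x _ => (hcomp i).differentiable (by simp) x
        · exact fun x _ => hφ.1.differentiable (by simp) x
    _ = -∫ x, divergence ψ x * φ x := by
        rw [Finset.sum_neg_distrib, ← integral_finsetSum _ fun i _ => hi' i]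
        simp only [divergence, Finset.sum_mul]

theorem IsWeakDiv.congr {Ω : Set E3} {u u' : E3 → E3} {d d' : E3 → ℝ} (h : IsWeakDiv Ω u d)
    (hu : u' =ᵐ[volume.restrict Ω] u) (hd : d' =ᵐ[volume.restrict Ω] d) : IsWeakDiv Ω u' d' := by
  intro φ hφ
  have h1 : ∫ x in Ω, inner ℝ (u' x) (gradient φ x) = ∫ x in Ω, inner ℝ (u x) (gradient φ x) :=
    integral_congr_ae (hu.mono fun x hx => by simp only [hx])
  have h2 : ∫ x in Ω, d' x * φ x = ∫ x in Ω, d x * φ x :=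
    integral_congr_ae (hd.mono fun x hx => by simp only [hx])
  rw [h1, h2, h φ hφ]

theorem WpDiv.exists_of_contDiff {Ω : Set E3} (hΩ : IsOpen Ω) (hb : Bornology.IsBounded Ω)
    (p : ℝ≥0∞) [Fact (1 ≤ p)] {ψ : E3 → E3} (hψ : ContDiff ℝ ∞ ψ) :
    ∃ w : WpDiv p Ω, field w =ᵐ[volume.restrict Ω] ψ ∧
      div w =ᵐ[volume.restrict Ω] divergence ψ := by
  have h1 := hb.memLp_of_continuous hΩ.measurableSet hψ.continuous p
  have h2 := hb.memLp_of_continuous hΩ.measurableSet hψ.continuous_divergence p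
  exact ⟨⟨WithLp.toLp 1 (h1.toLp ψ, h2.toLp (divergence ψ)),
    (hψ.isWeakDiv Ω).congr h1.coeFn_toLp h2.coeFn_toLp⟩, h1.coeFn_toLp, h2.coeFn_toLp⟩

theorem WpDiv.dist_eq {p : ℝ≥0∞} [Fact (1 ≤ p)] {Ω : Set E3} (v w : WpDiv p Ω) :
    dist v w = (eLpNorm (fun x => field v x - field w x) p (volume.restrict Ω)).toReal +
      (eLpNorm (fun x => div v x - div w x) p (volume.restrict Ω)).toReal := by
  rw [dist_eq_norm, norm_eq]
  change ‖field v - field w‖ + ‖div v - div w‖ = _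
  rw [Lp.norm_def, Lp.norm_def, eLpNorm_congr_ae (Lp.coeFn_sub _ _),
    eLpNorm_congr_ae (Lp.coeFn_sub _ _)]
  rfl

/-! ### Mollification with inward-shifted kernels -/

theorem UniformConeNear.mono {Ω U U' : Set E3} (h : UniformConeNear Ω U) (hU : U' ⊆ U) :
    UniformConeNear Ω U' := by
  obtain ⟨v, δ, r, hδ, hr, H⟩ := h
  exact ⟨v, δ, r, hδ, hr, fun x hx t h0 ht y hy => H x hx t h0 ht y (hU hy)⟩

/-- Smooth kernels of mass one, concentrated near `0`, whose mollifications at points of `Ω` only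
see those points of `U` that lie in `Ω`. -/
theorem UniformConeNear.exists_kernel {Ω U : Set E3} (h : UniformConeNear Ω U) {N : Set E3}
    (hN : N ∈ nhds (0 : E3)) :
    ∃ K : E3 → ℝ, ContDiff ℝ ∞ K ∧ HasCompactSupport K ∧ (∀ z, 0 ≤ K z) ∧ ∫ z, K z = 1 ∧
      (∀ z, K z ≠ 0 → z ∈ N) ∧ ∀ x ∈ Ω, ∀ y ∈ U, x - y ∈ tsupport K → y ∈ Ω := by
  obtain ⟨v, δ, r, hδ, hr, H⟩ := h
  obtain ⟨η, hη, hηN⟩ := Metric.mem_nhds_iff.1 hN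
  -- The first bound keeps t below the cone height; the second puts the ball of radius δt about -tv
  -- inside N.
  set t : ℝ := min (r / 2) (η / (‖v‖ + δ)) with ht
  have hvδ : 0 < ‖v‖ + δ := by positivity
  have ht0 : 0 < t := lt_min (half_pos hr) (by positivity)
  have htr : t < r := (min_le_left _ _).trans_lt (half_lt_self hr)
  have htη : t * (‖v‖ + δ) ≤ η := by
    rw [← le_div_iff₀ hvδ]
    exact min_le_right _ _
  -- The centre is -tv because convolution evaluates f at x - z, which is then close to x + tv.
  let b : ContDiffBump (-(t • v)) := ⟨δ * t / 2, δ * t, by positivity, half_lt_self (by positivity)⟩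
  refine ⟨b.normed volume, b.contDiff_normed, b.hasCompactSupport_normed,
    fun z => b.nonneg_normed z, b.integral_normed, fun z hz => hηN ?_, fun x hx y hy hxy => ?_⟩
  · have hz' : z ∈ Metric.ball (-(t • v)) (δ * t) := by
      rw [← b.support_normed_eq (μ := volume)]
      exact hz
    rw [mem_ball_iff_norm, sub_neg_eq_add] at hz'
    rw [mem_ball_zero_iff]
    have h1 : z = (z + t • v) - t • v := by abel
    have h2 := norm_sub_le (z + t • v) (t • v)
    rw [← h1, norm_smul, Real.norm_of_nonneg ht0.le] at h2
    linarith
  · rw [b.tsupport_normed_eq, mem_closedBall_iff_norm] at hxy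
    refine H x hx t ht0 htr y hy ?_
    rw [norm_sub_rev]
    rwa [show x + t • v - y = x - y - -(t • v) by abel]

theorem divergence_convolution {K : E3 → ℝ} (hK : ContDiff ℝ ∞ K) (hKs : HasCompactSupport K)
    {f : E3 → E3} (hf : LocallyIntegrable f volume) (x : E3) :
    divergence (convolution K f (ContinuousLinearMap.lsmul ℝ ℝ) volume) x =
      ∫ y, fderiv ℝ K (x - y) (f y) := by
  set L : ℝ →L[ℝ] E3 →L[ℝ] E3 := ContinuousLinearMap.lsmul ℝ ℝ with hL
  have hd := hKs.hasFDerivAt_convolution_left L (hK.of_le (by simp)) hf x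
  have hint : Integrable (fun z => L.precompL E3 (fderiv ℝ K z) (f (x - z))) volume :=
    (hKs.fderiv ℝ).convolutionExists_left (L.precompL E3) (hK.continuous_fderiv (by simp)) hf x
  -- The trace as a continuous linear functional, so that it passes through the Bochner integral.
  let T : (E3 →L[ℝ] E3) →L[ℝ] ℝ := ∑ i : Fin 3, (EuclideanSpace.proj (𝕜 := ℝ) i).comp
    (ContinuousLinearMap.apply ℝ E3 (EuclideanSpace.single i (1 : ℝ)))
  have hT : ∀ A : E3 →L[ℝ] E3, T A = ∑ i, A (EuclideanSpace.single i 1) i := fun A => by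
    simp [T]
  rw [← integral_sub_left_eq_self (fun y => fderiv ℝ K (x - y) (f y)) volume x]
  unfold divergence
  rw [hd.fderiv, ← hT, convolution, ← T.integral_comp_comm hint]
  refine integral_congr_ae (Filter.Eventually.of_forall fun z => ?_)
  simp only [hT, sub_sub_cancel]
  conv_rhs => rw [← sum_smul_single (f (x - z))]
  simp [hL, mul_comm]

theorem MeasureTheory.LocallyIntegrable.integrable_clm_apply {μ : Measure E3} {u : E3 → E3}
    (hu : LocallyIntegrable u μ) (hum : StronglyMeasurable u) {A : E3 → E3 →L[ℝ] ℝ}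
    (hA : Continuous A) (hAs : HasCompactSupport A) : Integrable (fun y => A y (u y)) μ := by
  have hb : Integrable (fun y => ‖u y‖ * ‖A y‖) μ :=
    LocallyIntegrable.integrable_smul_right_of_hasCompactSupport
      (fun x => (hu x).norm) hA.norm hAs.norm
  refine hb.mono' ((ContinuousLinearMap.apply ℝ ℝ).flip.continuous₂.comp_stronglyMeasurable
    (hA.stronglyMeasurable.prodMk hum)).aestronglyMeasurable
    (Filter.Eventually.of_forall fun y => ?_)
  rw [mul_comm]
  exact (A y).le_opNorm _

theorem inner_gradient_mul_comp_sub {χ K : E3 → ℝ} (hχ : ContDiff ℝ ∞ χ) (hK : ContDiff ℝ ∞ K)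
    (v x y : E3) : inner ℝ v (gradient (fun y => χ y * K (x - y)) y) =
      K (x - y) * fderiv ℝ χ y v - fderiv ℝ K (x - y) (χ y • v) := by
  have h : HasFDerivAt (fun y => K (x - y))
      ((fderiv ℝ K (x - y)).comp (-ContinuousLinearMap.id ℝ E3)) y :=
    ((hK.differentiable (by simp) (x - y)).hasFDerivAt).comp y ((hasFDerivAt_id y).const_sub x)
  have h' := ((hχ.differentiable (by simp) y).hasFDerivAt).mul h
  rw [inner_gradient_eq]
  refine (congrArg (fun A : E3 →L[ℝ] ℝ => A v) h'.fderiv).trans ?_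
  simp
  ring

/-- The weak divergence tested against a cut-off times a kernel. -/
theorem WpDiv.integral_fderiv_kernel {Ω : Set E3} {p : ℝ≥0∞} [Fact (1 ≤ p)] (w : WpDiv p Ω)
    {χ K : E3 → ℝ} (hχ : ContDiff ℝ ∞ χ) (hχs : HasCompactSupport χ) (hK : ContDiff ℝ ∞ K)
    {x : E3} (hKΩ : ∀ y ∈ tsupport χ, x - y ∈ tsupport K → y ∈ Ω) :
    ∫ y in Ω, fderiv ℝ K (x - y) (χ y • field w y) =
      ∫ y in Ω, K (x - y) * (χ y * div w y + fderiv ℝ χ y (field w y)) := by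
  have hum : StronglyMeasurable (field w) := Lp.stronglyMeasurable _
  have hul : LocallyIntegrable (field w) (volume.restrict Ω) :=
    (Lp.memLp (field w)).locallyIntegrable Fact.out
  have hKx : ContDiff ℝ ∞ fun y => K (x - y) := hK.comp (contDiff_const.sub contDiff_id)
  have hKc := hK.continuous
  have hKc' : Continuous (fderiv ℝ K) := hK.continuous_fderiv (by simp)
  have hχc := hχ.continuous
  have hχd : Continuous (fderiv ℝ χ) := hχ.continuous_fderiv (by simp)
  -- The support of χ may cross ∂Ω; `hKΩ` is what makes the product with the kernel admissible.
  have hφt : IsTestFunction Ω (fun y => χ y * K (x - y)) := by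
    refine ⟨hχ.mul hKx, HasCompactSupport.mul_right (f := χ) (f' := fun y => K (x - y)) hχs, fun y hy => hKΩ y (tsupport_mul_subset_left (f := χ) (g := fun y => K (x - y)) hy) ?_⟩
    exact tsupport_comp_subset_preimage K (f := fun y => x - y) (by fun_prop)
      (tsupport_mul_subset_right (f := χ) (g := fun y => K (x - y)) hy)
  have hw := isWeakDiv w _ hφt
  simp only [inner_gradient_mul_comp_sub hχ hK] at hw
  have hi1 : Integrable (fun y => fderiv ℝ K (x - y) (χ y • field w y)) (volume.restrict Ω) := by
    simp only [map_smul]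
    exact hul.integrable_clm_apply hum (A := fun y => χ y • fderiv ℝ K (x - y))
      (by fun_prop) (HasCompactSupport.smul_right (f := χ) (f' := fun y => fderiv ℝ K (x - y)) hχs)
  have hi2 : Integrable (fun y => K (x - y) * fderiv ℝ χ y (field w y)) (volume.restrict Ω) :=
    hul.integrable_clm_apply hum (A := fun y => K (x - y) • fderiv ℝ χ y)
      (by fun_prop) (HasCompactSupport.smul_left (f := fun y => K (x - y)) (f' := fderiv ℝ χ)
        (hχs.fderiv ℝ))
  have e : ∀ y, K (x - y) * (χ y * div w y + fderiv ℝ χ y (field w y)) =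
      div w y * (χ y * K (x - y)) + K (x - y) * fderiv ℝ χ y (field w y) := fun y => by ring
  simp only [e]
  rw [integral_sub hi2 hi1] at hw
  rw [integral_add (hφt.integrable_div _) hi2]
  linarith

/-- Localised fields can be approximated, together with their divergence, by smooth fields. -/
theorem WpDiv.exists_smooth_approx {Ω : Set E3} (hΩ : IsOpen Ω) {p : ℝ≥0∞} [Fact (1 ≤ p)]
    (hp : p ≠ ⊤) (w : WpDiv p Ω) {χ : E3 → ℝ} (hχ : ContDiff ℝ ∞ χ) (hχs : HasCompactSupport χ)
    (hcone : UniformConeNear Ω (tsupport χ)) {ε : ℝ≥0∞} (hε : 0 < ε) :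
    ∃ ψ : E3 → E3, ContDiff ℝ ∞ ψ ∧
      eLpNorm (fun x => ψ x - χ x • field w x) p (volume.restrict Ω) ≤ ε ∧
      eLpNorm (fun x => divergence ψ x - (χ x * div w x + fderiv ℝ χ x (field w x))) p
        (volume.restrict Ω) ≤ ε := by
  have hΩm := hΩ.measurableSet
  have hχd : Continuous (fderiv ℝ χ) := hχ.continuous_fderiv (by simp)
  obtain ⟨C, hC⟩ := hχs.exists_bound_of_continuous hχ.continuous
  obtain ⟨C', hC'⟩ := (hχs.fderiv ℝ).exists_bound_of_continuous hχd
  set f₀ : E3 → E3 := fun x => χ x • field w x with hf₀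
  set D₀ : E3 → ℝ := fun x => χ x * div w x + fderiv ℝ χ x (field w x) with hD₀
  have hum : StronglyMeasurable (field w) := Lp.stronglyMeasurable _
  have hdm : StronglyMeasurable (div w) := Lp.stronglyMeasurable _
  have hf₀m : StronglyMeasurable f₀ := hχ.continuous.stronglyMeasurable.smul hum
  have hg₀m : StronglyMeasurable fun x => fderiv ℝ χ x (field w x) :=
    (ContinuousLinearMap.apply ℝ ℝ).flip.continuous₂.comp_stronglyMeasurable
      (hχd.stronglyMeasurable.prodMk hum)
  have hD₀m : StronglyMeasurable D₀ := (hχ.continuous.stronglyMeasurable.mul hdm).add hg₀m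
  have hf₀p : MemLp f₀ p (volume.restrict Ω) := by
    refine (Lp.memLp (field w)).of_le_mul (c := C) hf₀m.aestronglyMeasurable
      (Filter.Eventually.of_forall fun x => ?_)
    rw [hf₀, norm_smul]
    exact mul_le_mul_of_nonneg_right (hC x) (norm_nonneg _)
  have hD₀p : MemLp D₀ p (volume.restrict Ω) := by
    refine MemLp.add ((Lp.memLp (div w)).of_le_mul (c := C)
      (hχ.continuous.stronglyMeasurable.mul hdm).aestronglyMeasurable
      (Filter.Eventually.of_forall fun x => ?_)) ((Lp.memLp (field w)).of_le_mul (c := C')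
      hg₀m.aestronglyMeasurable (Filter.Eventually.of_forall fun x => ?_))
    · rw [norm_mul]
      exact mul_le_mul_of_nonneg_right (hC x) (norm_nonneg _)
    · exact ((fderiv ℝ χ x).le_opNorm _).trans
        (mul_le_mul_of_nonneg_right (hC' x) (norm_nonneg _))
  set f : E3 → E3 := Ω.indicator f₀ with hf
  set D : E3 → ℝ := Ω.indicator D₀ with hD
  have hfm : StronglyMeasurable f := hf₀m.indicator hΩm
  have hDm : StronglyMeasurable D := hD₀m.indicator hΩm
  have hfp : MemLp f p volume := (memLp_indicator_iff_restrict hΩm).2 hf₀p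
  have hDp : MemLp D p volume := (memLp_indicator_iff_restrict hΩm).2 hD₀p
  have hfl : LocallyIntegrable f volume := hfp.locallyIntegrable Fact.out
  have hDl : LocallyIntegrable D volume := hDp.locallyIntegrable Fact.out
  -- One neighbourhood serves both f and D, since the same kernel must mollify the field and its
  -- divergence.
  have hN := ((hfp.tendsto_eLpNorm_translate_sub hp).eventually_le_const hε).and
    ((hDp.tendsto_eLpNorm_translate_sub hp).eventually_le_const hε)
  obtain ⟨K, hK, hKs, hK0, hK1, hKN, hKΩ⟩ := hcone.exists_kernel hN
  refine ⟨convolution K f (ContinuousLinearMap.lsmul ℝ ℝ) volume,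
    hKs.contDiff_convolution_left _ hK hfl, ?_, ?_⟩
  · refine le_trans (le_of_eq (eLpNorm_congr_ae ?_)) ((eLpNorm_mono_measure _
      Measure.restrict_le_self).trans (eLpNorm_convolution_sub_le hp hfm hfl hK.continuous hKs hK0
        hK1 fun z hz => (hKN z hz).1))
    filter_upwards [ae_restrict_mem hΩm] with x hx
    rw [hf, indicator_of_mem hx]
  · refine le_trans (le_of_eq (eLpNorm_congr_ae ?_)) ((eLpNorm_mono_measure _
      Measure.restrict_le_self).trans (eLpNorm_convolution_sub_le hp hDm hDl hK.continuous hKs hK0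
        hK1 fun z hz => (hKN z hz).2))
    filter_upwards [ae_restrict_mem hΩm] with x hx
    rw [hD, indicator_of_mem hx]
    refine congrArg (· - D₀ x) ?_
    rw [divergence_convolution hK hKs hfl, convolution_eq_swap]
    have e1 : ∫ y, fderiv ℝ K (x - y) (f y) = ∫ y in Ω, fderiv ℝ K (x - y) (f₀ y) := by
      rw [← integral_indicator hΩm]
      refine integral_congr_ae (Filter.Eventually.of_forall fun y => ?_)
      by_cases hy : y ∈ Ω <;> simp [hf, hy]
    have e2 : ∫ y, ContinuousLinearMap.lsmul ℝ ℝ (K (x - y)) (D y) =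
        ∫ y in Ω, K (x - y) * D₀ y := by
      rw [← integral_indicator hΩm]
      refine integral_congr_ae (Filter.Eventually.of_forall fun y => ?_)
      by_cases hy : y ∈ Ω <;> simp [hD, hy]
    rw [e1, e2]
    exact integral_fderiv_kernel w hχ hχs hK (hKΩ x hx)

/-! ### Gluing and density -/

/-- The cut-offs sum to 1 on the closure, hence their derivatives sum to 0 on the open set Ω: the
local terms χᵢ div u + ∇χᵢ·u add up to div u. -/
theorem WpDiv.exists_contDiff_near {Ω : Set E3} (hΩ : IsOpen Ω) (hb : Bornology.IsBounded Ω)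
    (hL : HasLipschitzBoundary Ω) {p : ℝ≥0∞} [Fact (1 ≤ p)] (hp : p ≠ ⊤) (w : WpDiv p Ω)
    {ε : ℝ≥0∞} (hε : 0 < ε) :
    ∃ ψ : E3 → E3, ContDiff ℝ ∞ ψ ∧
      eLpNorm (fun x => ψ x - field w x) p (volume.restrict Ω) ≤ ε ∧
      eLpNorm (fun x => divergence ψ x - div w x) p (volume.restrict Ω) ≤ ε := by
  have hΩm := hΩ.measurableSet
  have hc : IsCompact (closure Ω) := hb.isCompact_closure
  choose! U hUo hxU hU using fun x (hx : x ∈ closure Ω) => hL.exists_uniformConeNear hΩ hx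
  -- Intersecting with unit balls gives the cut-offs compact support.
  obtain ⟨t, htΩ, htc⟩ := hc.elim_nhds_subcover (fun x => U x ∩ Metric.ball x 1) fun x hx =>
    ((hUo x hx).inter Metric.isOpen_ball).mem_nhds ⟨hxU x hx, Metric.mem_ball_self one_pos⟩
  obtain ⟨χ, hχU⟩ := SmoothPartitionOfUnity.exists_isSubordinate (modelWithCornersSelf ℝ E3)
    isClosed_closure (fun x : t => U x ∩ Metric.ball x.1 1)
    (fun x => (hUo x (htΩ x x.2)).inter Metric.isOpen_ball) (by
      intro x hx
      obtain ⟨i, hi, hxi⟩ := mem_iUnion₂.1 (htc hx)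
      exact mem_iUnion.2 ⟨⟨i, hi⟩, hxi⟩)
  have hχ : ∀ i, ContDiff ℝ ∞ (χ i) := fun i => (χ i).contMDiff.contDiff
  have hχs : ∀ i, HasCompactSupport (χ i) := fun i =>
    HasCompactSupport.of_support_subset_isCompact (isCompact_closedBall i.1 1)
      ((subset_tsupport _).trans ((hχU i).trans (inter_subset_right.trans
        Metric.ball_subset_closedBall)))
  have hsum : ∀ x ∈ closure Ω, ∑ i, χ i x = 1 := fun x hx => by
    rw [← finsum_eq_sum_of_fintype]
    exact χ.sum_eq_one hx
  have hsum' : ∀ x ∈ Ω, ∑ i, fderiv ℝ (χ i) x = 0 := fun x hx => by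
    rw [← fderiv_fun_sum fun i _ => (hχ i).differentiable (by simp) x]
    have h : (fun x => ∑ i, χ i x) =ᶠ[nhds x] fun _ => (1 : ℝ) :=
      Filter.mem_of_superset (hΩ.mem_nhds hx) fun y hy => hsum y (subset_closure hy)
    rw [h.fderiv_eq, fderiv_fun_const]
    rfl
  set δ : ℝ≥0∞ := ε / (Fintype.card t + 1) with hδ
  have hδ0 : 0 < δ := ENNReal.div_pos hε.ne' (by finiteness)
  have hδε : ∑ _i : t, δ ≤ ε := by
    rw [Finset.sum_const, nsmul_eq_mul, Finset.card_univ]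
    calc (Fintype.card t : ℝ≥0∞) * δ ≤ (Fintype.card t + 1) * δ := by gcongr; exact le_self_add
      _ ≤ ε := ENNReal.mul_div_le
  choose ψ hψ hψ1 hψ2 using fun i => exists_smooth_approx hΩ hp w (hχ i) (hχs i)
    ((hU i (htΩ i i.2)).mono ((hχU i).trans inter_subset_left)) hδ0
  have hm1 : ∀ i, AEStronglyMeasurable (fun x => ψ i x - χ i x • field w x)
      (volume.restrict Ω) := fun i =>
    (hψ i).continuous.aestronglyMeasurable.sub
      ((hχ i).continuous.aestronglyMeasurable.smul (Lp.aestronglyMeasurable _))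
  have hm2 : ∀ i, AEStronglyMeasurable (fun x => divergence (ψ i) x -
      (χ i x * div w x + fderiv ℝ (χ i) x (field w x))) (volume.restrict Ω) := fun i =>
    (hψ i).continuous_divergence.aestronglyMeasurable.sub
      (((hχ i).continuous.aestronglyMeasurable.mul (Lp.aestronglyMeasurable _)).add
        ((ContinuousLinearMap.apply ℝ ℝ).flip.continuous₂.comp_aestronglyMeasurable
          (((hχ i).continuous_fderiv (by simp)).aestronglyMeasurable.prodMk
            (Lp.aestronglyMeasurable _))))
  refine ⟨fun x => ∑ i, ψ i x, ContDiff.sum fun i _ => hψ i, ?_, ?_⟩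
  · refine le_trans (le_of_eq (eLpNorm_congr_ae ?_)) ((eLpNorm_sum_le (fun i _ => hm1 i)
      Fact.out).trans ((Finset.sum_le_sum fun i _ => hψ1 i).trans hδε))
    filter_upwards [ae_restrict_mem hΩm] with x hx
    rw [Finset.sum_apply, Finset.sum_sub_distrib, ← Finset.sum_smul,
      hsum x (subset_closure hx), one_smul]
  · refine le_trans (le_of_eq (eLpNorm_congr_ae ?_)) ((eLpNorm_sum_le (fun i _ => hm2 i)
      Fact.out).trans ((Finset.sum_le_sum fun i _ => hψ2 i).trans hδε))
    filter_upwards [ae_restrict_mem hΩm] with x hx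
    rw [Finset.sum_apply, Finset.sum_sub_distrib, Finset.sum_add_distrib, ← Finset.sum_mul,
      hsum x (subset_closure hx), one_mul, ← sum_apply, hsum' x hx,
      divergence_sum _ fun i _ => hψ i]
    simp

/-- `C^∞(Ω̄)^3` is contained in `W^p(div; Ω)` and is dense in it. -/
theorem mainTheorem10 (Ω : Set E3) (hΩ : IsOpen Ω) (hb : Bornology.IsBounded Ω)
    (hL : HasLipschitzBoundary Ω) (p : ℝ≥0∞) [Fact (1 ≤ p)] (hp : 1 < p) (hp_top : p ≠ ⊤) :
    (∀ φ ∈ SmoothUpToBoundary Ω, ∃ w : WpDiv p Ω, WpDiv.field w =ᵐ[volume.restrict Ω] φ) ∧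
      Dense {w : WpDiv p Ω | ∃ φ ∈ SmoothUpToBoundary Ω, WpDiv.field w =ᵐ[volume.restrict Ω] φ} := by
  refine ⟨fun φ ⟨ψ, hψ, hφψ⟩ => ?_, Metric.dense_iff.2 fun w ε hε => ?_⟩
  · obtain ⟨w, hw, -⟩ := WpDiv.exists_of_contDiff hΩ hb p hψ
    refine ⟨w, hw.trans ?_⟩
    filter_upwards [ae_restrict_mem hΩ.measurableSet] with x hx
    exact (hφψ (subset_closure hx)).symm
  · obtain ⟨ψ, hψ, h1, h2⟩ := WpDiv.exists_contDiff_near hΩ hb hL hp_top w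
      (ε := ENNReal.ofReal (ε / 3)) (by simpa using hε)
    obtain ⟨w', hw', hd'⟩ := WpDiv.exists_of_contDiff hΩ hb p hψ
    refine ⟨w', ?_, ψ, ⟨ψ, hψ, fun _ _ => rfl⟩, hw'⟩
    have e1 : eLpNorm (fun x => WpDiv.field w' x - WpDiv.field w x) p (volume.restrict Ω) ≤
        ENNReal.ofReal (ε / 3) :=
      (eLpNorm_congr_ae (hw'.mono fun x hx => by simp only [hx])).trans_le h1
    have e2 : eLpNorm (fun x => WpDiv.div w' x - WpDiv.div w x) p (volume.restrict Ω) ≤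
        ENNReal.ofReal (ε / 3) :=
      (eLpNorm_congr_ae (hd'.mono fun x hx => by simp only [hx])).trans_le h2
    rw [Metric.mem_ball, WpDiv.dist_eq]
    have e1' := ENNReal.toReal_le_of_le_ofReal (by positivity) e1
    have e2' := ENNReal.toReal_le_of_le_ofReal (by positivity) e2
    linarith
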